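/- Let $G$ be a finite group. Write $\operatorname{Conj}(G)$ for its set of conjugacy classes, $\operatorname{Irr}(G)$ for the set of its irreducible complex characters, $d_\chi=\chi(1)$ for the degree of $\chi\in\operatorname{Irr}(G)$, and $\chi(C)$ for the constant value of $\chi$ on $C\in\operatorname{Conj}(G)$. The ZL-amenability constant of $G$ (the amenability constant of the centre of $\ell^1(G)$) is $$\operatorname{AM}_Z(G)=\frac{1}{|G|^2}\sum_{C,D\in\operatorname{Conj}(G)}\Bigl|\sum_{\chi\in\operatorname{Irr}(G)}d_\chi^2\,\chi(C)\,\overline{\chi(D)}\Bigr|\,|C|\,|D|.$$ Suppose that $G$ is a Frobenius group, that is, $G$ has a proper, non-trivial subgroup $H$ (a Frobenius complement) with $H\cap gHg^{-1}=\{e\}$ for all $g\in G\setminus H$; and let $K=\bigl(G\setminus\bigcup_{g\in G}gHg^{-1}\bigr)\cup\{e\}$ be the corresponding Frobenius kernel, which by a theorem of Frobenius is a subgroup of $G$. If $H$ and $K$ are both abelian, then $$\operatorname{AM}_Z(G)\ge \frac73,$$ with equality if and only if $G$ is isomorphic to the dihedral group of order $6$. -/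

import Mathlib

namespace ZLAmenability

/-- `Irr(G)`: the set of characters of the irreducible finite-dimensional complex representations
of `G`, as functions on `G`. Every such representation is isomorphic to one on some `ℂⁿ`, so only
these spaces are listed (see `character_mem_irr`). -/
def Irr (G : Type*) [Group G] : Set (G → ℂ) :=
  {χ | ∃ (n : ℕ) (ρ : Representation ℂ G (Fin n → ℂ)), ρ.IsIrreducible ∧ ρ.character = χ}

/-- A finite group has only finitely many irreducible characters. -/
instance finite_irr (G : Type*) [Group G] [Finite G] : Finite (Irr G) := by
  classical
  have := Fintype.ofFinite G
  have hG : (Nat.card G : ℂ) ≠ 0 := Nat.cast_ne_zero.2 Nat.card_pos.ne'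
  have : Invertible (Nat.card G : ℂ) := invertibleOfNonzero hG
  have orth : ∀ χ ψ : Irr G, (Nat.card G : ℂ)⁻¹ * ∑ g : G, χ.1 g * ψ.1 g⁻¹ =
      if χ = ψ then 1 else 0 := by
    rintro ⟨_, n, ρ, hρ, rfl⟩ ⟨_, m, σ, hσ, rfl⟩
    have h := Representation.char_orthonormal ρ σ
    have h' := Representation.char_orthonormal ρ ρ
    rw [if_pos ⟨.refl ρ⟩] at h'
    split_ifs with heq
    · have heq' : ρ.character = σ.character := congrArg Subtype.val heq
      simpa only [heq'] using h'
    · rw [if_neg] at h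
      · exact h
      · rintro ⟨e⟩
        exact heq (Subtype.ext (Representation.char_iso e).symm)
  have li : LinearIndependent ℂ (fun χ : Irr G => χ.1) := by
    rw [linearIndependent_iff']
    intro s c hc ψ hψ
    have h : (Nat.card G : ℂ)⁻¹ * ∑ g : G, (∑ χ ∈ s, c χ • χ.1) g * ψ.1 g⁻¹ = c ψ := by
      have : ∀ χ : Irr G, c χ * ((Nat.card G : ℂ)⁻¹ * ∑ g : G, χ.1 g * ψ.1 g⁻¹) =
          if χ = ψ then c χ else 0 := fun χ => by rw [orth]; split_ifs <;> simp
      calc _ = ∑ χ ∈ s, c χ * ((Nat.card G : ℂ)⁻¹ * ∑ g : G, χ.1 g * ψ.1 g⁻¹) := by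
            simp only [Finset.sum_apply, Pi.smul_apply, smul_eq_mul, Finset.sum_mul,
              Finset.mul_sum]
            rw [Finset.sum_comm]
            exact Finset.sum_congr rfl fun _ _ => Finset.sum_congr rfl fun _ _ => by ring
        _ = c ψ := by
            rw [Finset.sum_congr rfl fun χ _ => this χ]; simp [hψ]
    rw [← h, hc]
    simp
  exact li.finite

/-- The character of every irreducible finite-dimensional complex representation lies in `Irr G`. -/
theorem character_mem_irr {G V : Type*} [Group G] [AddCommGroup V] [Module ℂ V]
    [FiniteDimensional ℂ V] (ρ : Representation ℂ G V) (hρ : ρ.IsIrreducible) :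
    ρ.character ∈ Irr G := by
  let e : V ≃ₗ[ℂ] (Fin (Module.finrank ℂ V) → ℂ) := (Module.finBasis ℂ V).equivFun
  let σ : Representation ℂ G (Fin (Module.finrank ℂ V) → ℂ) :=
    { toFun := fun g => e.conj (ρ g)
      map_one' := by rw [map_one]; exact e.conj_id
      map_mul' := fun a b => by rw [map_mul]; exact e.conj_comp _ _ }
  have hσ : ∀ g v, σ g v = e (ρ g (e.symm v)) := fun _ _ => rfl
  let o : Subrepresentation ρ ≃o Subrepresentation σ :=
    { toFun := fun W => ⟨W.toSubmodule.comap e.symm.toLinearMap, fun g v hv => by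
        simpa [hσ] using W.apply_mem_toSubmodule g hv⟩
      invFun := fun W => ⟨W.toSubmodule.comap e.toLinearMap, fun g v hv => by
        simpa [hσ] using W.apply_mem_toSubmodule g hv⟩
      left_inv := fun W => by ext v; change e.symm (e v) ∈ W.toSubmodule ↔ v ∈ W.toSubmodule; simp
      right_inv := fun W => by ext v; change e (e.symm v) ∈ W.toSubmodule ↔ v ∈ W.toSubmodule; simp
      map_rel_iff' := fun {W W'} => by
        refine ⟨fun h v hv => ?_, fun h v hv => h hv⟩
        have : e v ∈ W'.toSubmodule.comap e.symm.toLinearMap := h (by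
          change e.symm (e v) ∈ W.toSubmodule
          rw [e.symm_apply_apply]; exact hv)
        change e.symm (e v) ∈ W'.toSubmodule at this
        rw [e.symm_apply_apply] at this; exact this }
  refine ⟨_, σ, o.isSimpleOrder_iff.1 hρ, ?_⟩
  funext g
  exact LinearMap.trace_conj' (ρ g) e

/-- The value `χ(C)` of an irreducible character on a conjugacy class, i.e. its value at any
element of the class. -/
def classValue {G : Type*} [Group G] (χ : Irr G) (C : ConjClasses G) : ℂ :=
  Quotient.liftOn C χ.1 (by
    obtain ⟨_, n, ρ, hρ, rfl⟩ := χ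
    intro a b hab
    obtain ⟨c, rfl⟩ := isConj_iff.1 hab
    exact (ρ.char_conj a c).symm)

/-- The degree `d_χ = χ(1)` of a character, the dimension of the representation (see
`degree_eq`). -/
def degree {G : Type*} [Group G] (χ : Irr G) : ℂ := χ.1 1

theorem degree_eq {G : Type*} [Group G] {n : ℕ} (ρ : Representation ℂ G (Fin n → ℂ))
    (hρ : ρ.IsIrreducible) : degree ⟨ρ.character, n, ρ, hρ, rfl⟩ = n := by
  simp [degree]

/-- The ZL-amenability constant of a finite group `G`:
`|G|⁻² ∑_{C, D ∈ Conj(G)} |∑_{χ ∈ Irr(G)} d_χ² χ(C) conj(χ(D))| |C| |D|`. -/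
noncomputable def AMZ (G : Type*) [Group G] [Finite G] : ℝ :=
  letI : Fintype (ConjClasses G) := Fintype.ofFinite _
  letI : Fintype (Irr G) := Fintype.ofFinite _
  1 / (Nat.card G : ℝ) ^ 2 * ∑ C : ConjClasses G, ∑ D : ConjClasses G,
    ‖∑ χ : Irr G, degree χ ^ 2 * classValue χ C * (starRingEnd ℂ) (classValue χ D)‖ *
      (Nat.card C.carrier : ℝ) * (Nat.card D.carrier : ℝ)

/-- `H` is a Frobenius complement in `G`: a proper, non-trivial, malnormal subgroup, where
malnormal means `H ∩ gHg⁻¹ = {1}` for all `g ∈ G \ H`. A finite group is a Frobenius group if it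
has a Frobenius complement. -/
structure IsFrobeniusComplement {G : Type*} [Group G] (H : Subgroup G) : Prop where
  ne_bot : H ≠ ⊥
  ne_top : H ≠ ⊤
  malnormal : ∀ g : G, g ∉ H → H ⊓ H.map (MulAut.conj g).toMonoidHom = ⊥

/-- The Frobenius kernel `(G \ ⋃_g gHg⁻¹) ∪ {1}` belonging to `H`, as a subset of `G`. -/
def frobeniusKernel {G : Type*} [Group G] (H : Subgroup G) : Set G :=
  (⋃ g : G, (H.map (MulAut.conj g).toMonoidHom : Set G))ᶜ ∪ {1}

end ZLAmenability

/-! Write h = |H| and k = |ker π|. A malnormal abelian `H` is a retract of `G` under the transfer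
`π`, and `π.ker` lies in the Frobenius kernel, so it is abelian and Frobenius's theorem is not
needed. Malnormality then fixes the class structure: nontrivial elements of `π.ker` have centraliser
`π.ker`, and elements outside it have centralisers of order h.

The h characters of `H` pull back to linear characters of `G`. Counting classes leaves (k - 1)/h
others, each of degree at most h (`finrank_le`), and ∑ d² = hk forces each of these degrees to equal
h. The weights d² are thus 1 or h², so the inner sum defining `AMZ` is h² times column orthogonality
for `G` minus h² - 1 times that for `H` (`sum_degree_sq_mul`). Its sign is known on every pair,
which gives a closed formula in h and k (`AMZ_eq`).

Since h divides k - 1, k ≥ h + 1. On the region h ≥ 2, k ≥ h + 1 the formula has minimum 7/3,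
attained only at (2, 3), where `G` acts faithfully on the three cosets of `H`. -/

namespace ZLAmenability

open scoped MonoidAlgebra ComplexOrder

/-! ### Orthogonality relations for irreducible characters -/

section Orthogonality

variable {G : Type*} [Group G]

/-- Unitarian trick: averaging gives an invariant positive definite form `P`, which conjugates the
matrix of `g⁻¹` into the adjoint of the matrix of `g`; compare traces. -/
theorem character_inv_eq_conj [Fintype G] {n : ℕ} (ρ : Representation ℂ G (Fin n → ℂ)) (g : G) :
    ρ.character g⁻¹ = (starRingEnd ℂ) (ρ.character g) := by
  classical
  let A : G → Matrix (Fin n) (Fin n) ℂ := fun g => LinearMap.toMatrix' (ρ g)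
  have hmul : ∀ a b, A (a * b) = A a * A b := fun a b => by
    simp only [A, map_mul]; exact LinearMap.toMatrix'_mul _ _
  have hone : A 1 = 1 := by simp only [A, map_one]; exact LinearMap.toMatrix'_one
  have htr : ∀ g, ρ.character g = (A g).trace := fun g => by
    simp only [A, Representation.character]
    rw [LinearMap.trace_eq_matrix_trace ℂ (Pi.basisFun ℂ (Fin n))]
    rfl
  let P : Matrix (Fin n) (Fin n) ℂ := ∑ a : G, (A a).conjTranspose * A a
  have hpos : P.PosDef := by
    have hP : P = 1 + ∑ a ∈ Finset.univ.erase (1 : G), (A a).conjTranspose * A a := by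
      simp only [P]
      rw [← Finset.add_sum_erase _ _ (Finset.mem_univ (1 : G)), hone]
      simp
    rw [hP]
    exact Matrix.PosDef.one.add_posSemidef
      (Matrix.posSemidef_sum _ fun a _ => Matrix.posSemidef_conjTranspose_mul_self _)
  have hinv : (A g).conjTranspose * P * A g = P := by
    simp only [P, Finset.mul_sum, Finset.sum_mul]
    refine Fintype.sum_equiv (Equiv.mulRight g) _ _ fun a => ?_
    simp [hmul, Matrix.conjTranspose_mul, Matrix.mul_assoc]
  have hu : IsUnit P.det := (Matrix.isUnit_iff_isUnit_det _).1 hpos.isUnit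
  have hAA : A g * A g⁻¹ = 1 := by rw [← hmul, mul_inv_cancel, hone]
  have key : (A g).conjTranspose = P * A g⁻¹ * P⁻¹ := by
    calc (A g).conjTranspose = (A g).conjTranspose * P * (A g * A g⁻¹) * P⁻¹ := by
          rw [hAA, mul_one, Matrix.mul_nonsing_inv_cancel_right _ _ hu]
      _ = P * A g⁻¹ * P⁻¹ := by rw [← mul_assoc ((A g).conjTranspose * P), hinv]
  rw [htr, htr, starRingEnd_apply, ← Matrix.trace_conjTranspose, key, Matrix.trace_mul_comm,
    ← mul_assoc, Matrix.nonsing_inv_mul _ hu, one_mul]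

theorem Irr.apply_inv [Finite G] (χ : Irr G) (g : G) : χ.1 g⁻¹ = (starRingEnd ℂ) (χ.1 g) := by
  have := Fintype.ofFinite G
  obtain ⟨_, n, ρ, hρ, rfl⟩ := χ
  exact character_inv_eq_conj ρ g

theorem Irr.apply_eq_of_isConj (χ : Irr G) {a b : G} (h : IsConj a b) : χ.1 a = χ.1 b := by
  obtain ⟨_, n, ρ, hρ, rfl⟩ := χ
  obtain ⟨c, rfl⟩ := isConj_iff.1 h
  exact (ρ.char_conj a c).symm

open Classical in
theorem Irr.sum_mul_inv [Fintype G] (χ ψ : Irr G) :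
    ∑ g : G, χ.1 g * ψ.1 g⁻¹ = if χ = ψ then (Nat.card G : ℂ) else 0 := by
  have hG : (Nat.card G : ℂ) ≠ 0 := Nat.cast_ne_zero.2 Nat.card_pos.ne'
  have : Invertible (Nat.card G : ℂ) := invertibleOfNonzero hG
  suffices h : (Nat.card G : ℂ)⁻¹ * ∑ g : G, χ.1 g * ψ.1 g⁻¹ = if χ = ψ then 1 else 0 by
    rw [inv_mul_eq_iff_eq_mul₀ hG] at h
    rw [h]; split_ifs <;> simp
  obtain ⟨_, n, ρ, hρ, rfl⟩ := χ
  obtain ⟨_, m, σ, hσ, rfl⟩ := ψ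
  have h := Representation.char_orthonormal ρ σ
  have h' := Representation.char_orthonormal ρ ρ
  rw [if_pos ⟨.refl ρ⟩] at h'
  split_ifs with heq
  · have heq' : ρ.character = σ.character := congrArg Subtype.val heq
    simpa only [heq'] using h'
  · rw [if_neg] at h
    · exact h
    · rintro ⟨e⟩
      exact heq (Subtype.ext (Representation.char_iso e).symm)

/-- By Schur's lemma, a class function orthogonal to an irreducible character acts as zero. -/
theorem sum_smul_eq_zero_of_irreducible [Fintype G] {V : Type*} [AddCommGroup V] [Module ℂ V]
    [FiniteDimensional ℂ V] (ρ : Representation ℂ G V) (hρ : ρ.IsIrreducible) (f : G → ℂ)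
    (hf : ∀ a g, f (a * g * a⁻¹) = f g) (h0 : ∑ g, f g * ρ.character g⁻¹ = 0) :
    ∑ g, f g • ρ g⁻¹ = 0 := by
  let T : V →ₗ[ℂ] V := ∑ g, f g • ρ g⁻¹
  have hT : ∀ a, T ∘ₗ ρ a = ρ a ∘ₗ T := fun a => by
    change T * ρ a = ρ a * T
    simp only [T, Finset.sum_mul, Finset.mul_sum]
    rw [← (MulAut.conj a).toEquiv.sum_comp]
    refine Finset.sum_congr rfl fun g _ => ?_
    simp only [MulEquiv.toEquiv_eq_coe, EquivLike.coe_coe, MulAut.conj_apply, hf, smul_mul_assoc,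
      mul_smul_comm, ← map_mul]
    congr 2
    group
  obtain ⟨c, hc⟩ :=
    (Representation.IsIrreducible.algebraMap_intertwiningMap_bijective_of_isAlgClosed
      (ρ := ρ)).2 (⟨T, hT⟩ : Representation.IntertwiningMap ρ ρ)
  have hTc : T = c • LinearMap.id := by
    ext v
    have := DFunLike.congr_fun hc v
    simpa using this.symm
  have htr : LinearMap.trace ℂ V T = 0 := by
    simpa [T, map_sum, Representation.character] using h0
  have hnt : Nontrivial V := by
    by_contra hV
    rw [not_nontrivial_iff_subsingleton] at hV
    apply (bot_ne_top : (⊥ : Subrepresentation ρ) ≠ ⊤)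
    ext v
    simp [Subsingleton.elim v 0]
  have hc0 : c = 0 := by
    rw [hTc, map_smul, LinearMap.trace_id, smul_eq_mul, mul_eq_zero] at htr
    exact htr.resolve_right (Nat.cast_ne_zero.2 Module.finrank_pos.ne')
  change T = 0
  rw [hTc, hc0, zero_smul]

/-- A class function orthogonal to all irreducible characters vanishes. -/
theorem eq_zero_of_orthogonal_irr [Fintype G] (f : G → ℂ)
    (hf : ∀ a g, f (a * g * a⁻¹) = f g) (h0 : ∀ χ : Irr G, ∑ g, f g * χ.1 g⁻¹ = 0) :
    f = 0 := by
  classical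
  have : NeZero (Nat.card G : ℂ) := ⟨Nat.cast_ne_zero.2 Nat.card_pos.ne'⟩
  -- `z` is central, so its annihilator `N` is a submodule. Schur's lemma puts every simple
  -- submodule of `ℂ[G]` in `N`, semisimplicity then gives `N = ⊤`, and `1 ∈ N` means `z = 0`.
  let z : ℂ[G] := ∑ g, MonoidAlgebra.single g⁻¹ (f g)
  have hz : ∀ a : G, z * MonoidAlgebra.single a 1 = MonoidAlgebra.single a 1 * z := fun a => by
    simp only [z, Finset.sum_mul, Finset.mul_sum, MonoidAlgebra.single_mul_single, mul_one, one_mul]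
    rw [← (MulAut.conj a).toEquiv.sum_comp]
    refine Finset.sum_congr rfl fun g _ => ?_
    simp only [MulEquiv.toEquiv_eq_coe, EquivLike.coe_coe, MulAut.conj_apply, hf]
    congr 1
    group
  have hzc : ∀ x : ℂ[G], z * x = x * z := fun x => by
    induction x using MonoidAlgebra.induction_linear with
    | zero => simp
    | add x y hx hy => rw [mul_add, add_mul, hx, hy]
    | single a r =>
      have : MonoidAlgebra.single a r = r • MonoidAlgebra.single (R := ℂ) a 1 := by
        rw [MonoidAlgebra.smul_single, smul_eq_mul, mul_one]
      rw [this, mul_smul_comm, hz, smul_mul_assoc]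
  let N : Submodule ℂ[G] ℂ[G] :=
    { carrier := {x | z * x = 0}
      add_mem' := fun {x y} hx hy => by
        change z * (x + y) = 0
        rw [mul_add, hx, hy, add_zero]
      zero_mem' := mul_zero z
      smul_mem' := fun c x hx => by
        change z * (c * x) = 0
        rw [← mul_assoc, hzc, mul_assoc, hx, mul_zero] }
  have hN : N = ⊤ := by
    rw [eq_top_iff, ← IsSemisimpleModule.sSup_simples_eq_top]
    refine sSup_le fun m hm x hx => ?_
    have hfin : FiniteDimensional ℂ m :=
      inferInstanceAs (FiniteDimensional ℂ (m.restrictScalars ℂ))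
    let σ : Representation ℂ G m := Representation.ofModule' m
    have hσ : ∀ g y, σ g y = MonoidAlgebra.single (R := ℂ) g 1 • y := fun g y => by
      simp [σ, Representation.ofModule']
    have hirr : σ.IsIrreducible :=
      { exists_pair_ne := by
          refine ⟨⊥, ⊤, fun h => ?_⟩
          have := hm.nontrivial
          obtain ⟨y, hy⟩ := exists_ne (0 : m)
          have : y ∈ (⊥ : Subrepresentation σ) := h ▸ Submodule.mem_top (R := ℂ) (x := y)
          exact hy this
        eq_bot_or_eq_top := fun W => by
          let W' : Submodule ℂ[G] m :=
            { W.toSubmodule with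
              smul_mem' := fun c y hy => by
                induction c using MonoidAlgebra.induction_linear with
                | zero => rw [zero_smul]; exact W.toSubmodule.zero_mem
                | add a b ha hb => rw [add_smul]; exact W.toSubmodule.add_mem ha hb
                | single g r =>
                  have : MonoidAlgebra.single g r = r • MonoidAlgebra.single (R := ℂ) g 1 := by
                    rw [MonoidAlgebra.smul_single, smul_eq_mul, mul_one]
                  rw [this, smul_assoc, ← hσ]
                  exact W.toSubmodule.smul_mem _ (W.apply_mem_toSubmodule g hy) }
          have : IsSimpleModule ℂ[G] m := hm
          rcases eq_bot_or_eq_top W' with h | h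
          · left
            ext y
            exact (SetLike.ext_iff.1 h y)
          · right
            ext y
            exact (SetLike.ext_iff.1 h y) }
    have h := LinearMap.congr_fun (sum_smul_eq_zero_of_irreducible σ hirr f hf
      (h0 ⟨_, character_mem_irr σ hirr⟩)) ⟨x, hx⟩
    have h2 := congrArg (Subtype.val : m → ℂ[G]) h
    simp only [LinearMap.sum_apply, LinearMap.smul_apply, hσ, LinearMap.zero_apply] at h2
    change z * x = 0
    rw [Finset.sum_mul]
    refine Eq.trans ?_ h2
    rw [AddSubmonoidClass.coe_finsetSum]
    refine Finset.sum_congr rfl fun g _ => ?_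
    rw [← smul_assoc, MonoidAlgebra.smul_single, smul_eq_mul, mul_one]
    rfl
  have h1 : (1 : ℂ[G]) ∈ N := hN ▸ Submodule.mem_top
  have hz0 : z = 0 := by
    have : z * 1 = 0 := h1
    rwa [mul_one] at this
  funext g
  have := congrArg (fun w : ℂ[G] => w.coeff g⁻¹) hz0
  simpa [z, MonoidAlgebra.coeff_sum, Finsupp.single_apply] using this

open Classical in
theorem card_isConj_mul_card_centralizer [Fintype G] (b : G) :
    (Finset.univ.filter fun g => IsConj g b).card * Nat.card (Subgroup.centralizer {b}) =
      Nat.card G := by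
  have h := MulAction.card_orbit_mul_card_stabilizer_eq_card_group (ConjAct G) b
  rw [← Nat.card_eq_fintype_card, ← Nat.card_eq_fintype_card, ← Nat.card_eq_fintype_card,
    ← Subgroup.nat_card_centralizer_nat_card_stabilizer] at h
  have h2 : (Finset.univ.filter fun g => IsConj g b).card =
      Nat.card (MulAction.orbit (ConjAct G) b) := by
    rw [Nat.card_eq_fintype_card, ← Set.toFinset_card]
    congr 1
    ext g
    simp [ConjAct.mem_orbit_conjAct]
  rw [h2, h]
  exact Nat.card_congr ConjAct.ofConjAct.toEquiv

open Classical in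
/-- Column orthogonality. -/
theorem Irr.sum_apply_mul_inv_apply [Fintype G] [Fintype (Irr G)] (a b : G) :
    ∑ χ : Irr G, χ.1 a * χ.1 b⁻¹ =
      if IsConj a b then (Nat.card (Subgroup.centralizer {b}) : ℂ) else 0 := by
  -- The difference of the two sides, as a class function of `a`; row orthogonality makes it
  -- orthogonal to every irreducible character.
  let f : G → ℂ := fun g => (if IsConj g b then (Nat.card (Subgroup.centralizer {b}) : ℂ) else 0) -
    ∑ χ : Irr G, χ.1 g * χ.1 b⁻¹
  have hf : ∀ x g, f (x * g * x⁻¹) = f g := fun x g => by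
    have hc : IsConj (x * g * x⁻¹) g := (isConj_iff.2 ⟨x, rfl⟩).symm
    have h1 : IsConj (x * g * x⁻¹) b ↔ IsConj g b := ⟨hc.symm.trans, hc.trans⟩
    simp only [f, h1, Irr.apply_eq_of_isConj _ hc]
  have h0 : ∀ ψ : Irr G, ∑ g, f g * ψ.1 g⁻¹ = 0 := fun ψ => by
    simp only [f, sub_mul, Finset.sum_sub_distrib]
    rw [sub_eq_zero]
    have e1 : ∑ g, (if IsConj g b then (Nat.card (Subgroup.centralizer {b}) : ℂ) else 0) *
        ψ.1 g⁻¹ = Nat.card G * ψ.1 b⁻¹ := by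
      rw [← card_isConj_mul_card_centralizer b]
      simp only [ite_mul, zero_mul]
      rw [← Finset.sum_filter, Finset.sum_congr rfl (g := fun _ =>
        (Nat.card (Subgroup.centralizer {b}) : ℂ) * ψ.1 b⁻¹), Finset.sum_const, nsmul_eq_mul]
      · push_cast; ring
      · intro g hg
        rw [Irr.apply_inv, Irr.apply_inv, Irr.apply_eq_of_isConj ψ (Finset.mem_filter.1 hg).2]
    rw [e1]
    simp only [Finset.sum_mul]
    rw [Finset.sum_comm]
    have : ∀ χ : Irr G, ∑ g, χ.1 g * χ.1 b⁻¹ * ψ.1 g⁻¹ =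
        if χ = ψ then (Nat.card G : ℂ) * χ.1 b⁻¹ else 0 := fun χ => by
      calc _ = (∑ g, χ.1 g * ψ.1 g⁻¹) * χ.1 b⁻¹ := by
            rw [Finset.sum_mul]; exact Finset.sum_congr rfl fun _ _ => by ring
        _ = _ := by rw [Irr.sum_mul_inv]; split_ifs <;> simp
    simp [this]
  have := congrFun (eq_zero_of_orthogonal_irr f hf h0) a
  exact (sub_eq_zero.1 this).symm

open Classical in
-- Sum χ(g)χ(g⁻¹) over all pairs, by rows and by columns.
theorem Irr.card_mul_card [Fintype G] [Fintype (Irr G)] :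
    Fintype.card (Irr G) * Nat.card G = ∑ g : G, Nat.card (Subgroup.centralizer {g}) := by
  have h : ∑ g : G, ∑ χ : Irr G, χ.1 g * χ.1 g⁻¹ =
      ∑ g : G, (Nat.card (Subgroup.centralizer {g}) : ℂ) :=
    Finset.sum_congr rfl fun g _ => by rw [Irr.sum_apply_mul_inv_apply, if_pos (IsConj.refl g)]
  rw [Finset.sum_comm] at h
  simp only [Irr.sum_mul_inv, if_true, Finset.sum_const, nsmul_eq_mul] at h
  exact_mod_cast h

/-- The ZL-amenability constant as a double sum over the group. -/
theorem AMZ_eq_sum [Fintype G] [Fintype (Irr G)] : AMZ G = 1 / (Nat.card G : ℝ) ^ 2 *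
    ∑ a : G, ∑ b : G, ‖∑ χ : Irr G, χ.1 1 ^ 2 * (χ.1 a * χ.1 b⁻¹)‖ := by
  classical
  let : Fintype (ConjClasses G) := Fintype.ofFinite _
  have key : ∀ φ : ConjClasses G → ℝ, ∑ a : G, φ (ConjClasses.mk a) =
      ∑ C, φ C * (Nat.card C.carrier : ℝ) := fun φ => by
    rw [← Finset.sum_fiberwise (g := fun a : G => ConjClasses.mk a)]
    refine Finset.sum_congr rfl fun C _ => ?_
    rw [Finset.sum_congr rfl (g := fun _ => φ C) fun a ha => by rw [(Finset.mem_filter.1 ha).2],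
      Finset.sum_const, nsmul_eq_mul, mul_comm]
    congr 2
    rw [Nat.card_eq_fintype_card, ← Set.toFinset_card]
    congr 1
    ext g
    simp [ConjClasses.mem_carrier_iff_mk_eq]
  unfold AMZ
  congr 1
  rw [Subsingleton.elim (Fintype.ofFinite (Irr G)) ‹Fintype (Irr G)›]
  have hF : ∀ a b : G, ∑ χ : Irr G, χ.1 1 ^ 2 * (χ.1 a * χ.1 b⁻¹) =
      ∑ χ : Irr G, degree χ ^ 2 * classValue χ (ConjClasses.mk a) *
        (starRingEnd ℂ) (classValue χ (ConjClasses.mk b)) := fun a b =>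
    Finset.sum_congr rfl fun χ _ => by rw [Irr.apply_inv, ← mul_assoc]; rfl
  simp only [hF]
  rw [key fun C => ∑ b : G, ‖∑ χ : Irr G, degree χ ^ 2 * classValue χ C *
    (starRingEnd ℂ) (classValue χ (ConjClasses.mk b))‖]
  refine Finset.sum_congr rfl fun C _ => ?_
  rw [key fun D => ‖∑ χ : Irr G, degree χ ^ 2 * classValue χ C *
    (starRingEnd ℂ) (classValue χ D)‖, Finset.sum_mul]
  exact Finset.sum_congr rfl fun D _ => by ring

end Orthogonality

/-! ### Characters of finite abelian groups -/

section FiniteAbelian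

open Classical in
theorem sum_monoidHom_units_apply (A : Type*) [CommGroup A] [Finite A] [Fintype (A →* ℂˣ)] (a : A) :
    ∑ ψ : A →* ℂˣ, (ψ a : ℂ) = if a = 1 then (Nat.card A : ℂ) else 0 := by
  have : NeZero (Monoid.exponent A) := ⟨Monoid.exponent_ne_zero_of_finite⟩
  split_ifs with ha
  · subst ha
    simp [← CommGroup.card_monoidHom_of_hasEnoughRootsOfUnity A ℂ]
  · obtain ⟨φ, hφ⟩ := CommGroup.exists_apply_ne_one_of_hasEnoughRootsOfUnity A ℂ ha
    have h : ∑ ψ : A →* ℂˣ, (ψ a : ℂ) = φ a * ∑ ψ : A →* ℂˣ, (ψ a : ℂ) := by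
      rw [Finset.mul_sum]
      exact (Fintype.sum_equiv (Equiv.mulLeft φ) _ _ fun ψ => by simp).symm
    have h2 : ((φ a : ℂ) - 1) * ∑ ψ : A →* ℂˣ, (ψ a : ℂ) = 0 := by linear_combination -h
    refine (mul_eq_zero.1 h2).resolve_left fun h3 => hφ (Units.ext ?_)
    simpa [sub_eq_zero] using h3

/-- A finite abelian group acting linearly has a common eigenvector. -/
theorem exists_common_eigenvector {A V : Type*} [CommGroup A] [Finite A] [AddCommGroup V]
    [Module ℂ V] [Nontrivial V] (ρ : Representation ℂ A V) :
    ∃ (ψ : A →* ℂˣ) (w : V), w ≠ 0 ∧ ∀ a, ρ a w = (ψ a : ℂ) • w := by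
  classical
  have := Fintype.ofFinite A
  have := Fintype.ofFinite (A →* ℂˣ)
  obtain ⟨v, hv⟩ := exists_ne (0 : V)
  -- The projections of `v` to the eigenspaces, scaled by |A|, add up to |A| • v, so one of them is
  -- nonzero.
  have hsum : ∑ ψ : A →* ℂˣ, ∑ a : A, (ψ a⁻¹ : ℂ) • ρ a v = (Nat.card A : ℂ) • v := by
    rw [Finset.sum_comm]
    simp only [← Finset.sum_smul, sum_monoidHom_units_apply, inv_eq_one]
    simp [ite_smul]
  have hne : ∑ ψ : A →* ℂˣ, ∑ a : A, (ψ a⁻¹ : ℂ) • ρ a v ≠ 0 := by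
    rw [hsum]
    exact smul_ne_zero (Nat.cast_ne_zero.2 Nat.card_pos.ne') hv
  obtain ⟨ψ, -, hψ⟩ := Finset.exists_ne_zero_of_sum_ne_zero hne
  refine ⟨ψ, _, hψ, fun b => ?_⟩
  rw [map_sum, Finset.smul_sum]
  refine Fintype.sum_equiv (Equiv.mulLeft b) _ _ fun a => ?_
  rw [map_smul, Equiv.coe_mulLeft, smul_smul, map_mul, Module.End.mul_apply, mul_inv_rev, map_mul,
    Units.val_mul]
  congr 1
  have : (ψ b : ℂ) * (ψ b⁻¹ : ℂ) = 1 := by rw [← Units.val_mul, ← map_mul]; simp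
  linear_combination (-(ψ a⁻¹ : ℂ)) * this

end FiniteAbelian

/-! ### The transfer retraction, conjugacy and centralisers -/

section Retraction

variable {G : Type*} [Group G] {H : Subgroup G}

/-- A malnormal abelian subgroup of a finite group is a retract (by the transfer). -/
theorem exists_retraction [Finite G] (hmal : ∀ g ∉ H, ∀ x ∈ H, g * x * g⁻¹ ∈ H → x = 1)
    (hab : ∀ x ∈ H, ∀ y ∈ H, x * y = y * x) : ∃ π : G →* H, ∀ x : H, π x = x := by
  classical
  let : CommGroup H := { mul_comm := fun x y => Subtype.ext (hab x x.2 y y.2) }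
  refine ⟨MonoidHom.transfer (MonoidHom.id H), fun x => ?_⟩
  by_cases hx : x = 1
  · subst hx; simp
  have := Fintype.ofFinite
    (Quotient (MulAction.orbitRel (Subgroup.zpowers (x : G)) (G ⧸ H)))
  -- The transfer of `x` is a product over ⟨x⟩-orbits on `G ⧸ H`. The fixed base coset contributes
  -- `x`. Every other factor lies in `H` and is conjugate, by an element outside `H`, to a power of
  -- `x`, so malnormality kills it.
  rw [MonoidHom.transfer_eq_prod_quotient_orbitRel_zpowers_quot]
  have hfix : ∀ y : G ⧸ H, y = ((1 : G) : G ⧸ H) → (x : G) • y = y := by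
    rintro _ rfl
    rw [MulAction.Quotient.smul_coe, smul_eq_mul, mul_one, QuotientGroup.eq]
    simp
  let q₀ : Quotient (MulAction.orbitRel (Subgroup.zpowers (x : G)) (G ⧸ H)) :=
    Quotient.mk'' ((1 : G) : G ⧸ H)
  have hq₀ : q₀.out = ((1 : G) : G ⧸ H) := by
    have h : q₀.out ∈ MulAction.orbit (Subgroup.zpowers (x : G)) ((1 : G) : G ⧸ H) :=
      MulAction.orbitRel_apply.1 (Quotient.mk_out (s := MulAction.orbitRel _ _) _)
    obtain ⟨⟨z, hz⟩, h⟩ := h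
    rw [← h]
    change z • ((1 : G) : G ⧸ H) = _
    rw [MulAction.Quotient.smul_coe, smul_eq_mul, mul_one, QuotientGroup.eq]
    simpa using (Subgroup.zpowers_le.2 x.2) hz
  have hout : ∀ y : G ⧸ H, y.out ∈ H ↔ y = ((1 : G) : G ⧸ H) := fun y => by
    conv_rhs => rw [← QuotientGroup.out_eq' y, eq_comm, QuotientGroup.eq]
    simp
  rw [Fintype.prod_eq_single q₀]
  · have hp : Function.minimalPeriod ((x : G) • ·) q₀.out = 1 :=
      Function.minimalPeriod_eq_one_iff_isFixedPt.2 (hfix _ hq₀)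
    apply Subtype.ext
    simp only [hp, MonoidHom.id_apply, pow_one]
    -- The chosen representative of the base coset is only known to lie in `H`; commutativity
    -- removes it.
    rw [mul_assoc, hab _ x.2 _ ((hout _).2 hq₀), inv_mul_cancel_left]
  · intro q hq
    have ht : q.out.out ∉ H := fun h => hq <| by
      rw [← Quotient.out_eq' q, (hout _).1 h]
    apply Subtype.ext
    refine hmal _ ht _ (QuotientGroup.out_conj_pow_minimalPeriod_mem H _ _) ?_
    have := H.pow_mem x.2 (Function.minimalPeriod ((x : G) • ·) q.out)
    convert this using 1
    simp only [MonoidHom.id_apply]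
    group

/-- A Frobenius group with abelian complement `H`, and abelian kernel given as that of a
retraction onto `H`. -/
structure IsAbelianFrobenius (H : Subgroup G) (π : G →* H) : Prop where
  ne_bot : H ≠ ⊥
  ne_top : H ≠ ⊤
  malnormal : ∀ g ∉ H, ∀ x ∈ H, g * x * g⁻¹ ∈ H → x = 1
  comm : ∀ x ∈ H, ∀ y ∈ H, x * y = y * x
  retract : ∀ x : H, π x = x
  ker_comm : ∀ x ∈ π.ker, ∀ y ∈ π.ker, x * y = y * x

/-- Only the inclusion of `π.ker` in the Frobenius kernel is needed: a conjugate of `y ∈ H` killed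
by `π` has `y = π y = 1`. -/
theorem IsFrobeniusComplement.exists_isAbelianFrobenius [Finite G] (hH : IsFrobeniusComplement H)
    (hHab : ∀ x ∈ H, ∀ y ∈ H, x * y = y * x)
    (hKab : ∀ x ∈ frobeniusKernel H, ∀ y ∈ frobeniusKernel H, x * y = y * x) :
    ∃ π : G →* H, IsAbelianFrobenius H π := by
  have hmal : ∀ g ∉ H, ∀ x ∈ H, g * x * g⁻¹ ∈ H → x = 1 := fun g hg x hx h => by
    have h1 : g * x * g⁻¹ ∈ H ⊓ H.map (MulAut.conj g).toMonoidHom := ⟨h, x, hx, rfl⟩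
    rw [hH.malnormal g hg, Subgroup.mem_bot] at h1
    simpa using h1
  obtain ⟨π, hπ⟩ := exists_retraction hmal hHab
  have hsub : ∀ x ∈ π.ker, x ∈ frobeniusKernel H := fun x hx => by
    by_cases h : ∃ g, x ∈ H.map (MulAut.conj g).toMonoidHom
    · right
      obtain ⟨g, y, hy, rfl⟩ := h
      have h1 : π g * π y * (π g)⁻¹ = 1 := by
        simpa [MonoidHom.mem_ker] using hx
      rw [conj_eq_one_iff, hπ ⟨y, hy⟩] at h1
      have h2 : y = 1 := congrArg Subtype.val h1
      simp [h2]
    · left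
      simpa using h
  exact ⟨π, hH.ne_bot, hH.ne_top, hmal, hHab, hπ,
    fun x hx y hy => hKab x (hsub x hx) y (hsub y hy)⟩

namespace IsAbelianFrobenius

variable {π : G →* H} (h : IsAbelianFrobenius H π)

include h

theorem apply_apply (g : G) : π (π g : G) = π g := h.retract _

theorem inv_mul_mem_ker (g : G) : (π g : G)⁻¹ * g ∈ π.ker := by
  rw [MonoidHom.mem_ker, map_mul, map_inv, h.apply_apply, inv_mul_cancel]

theorem eq_one_of_mem {x : G} (hx : x ∈ H) (hx' : x ∈ π.ker) : x = 1 :=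
  congrArg Subtype.val ((h.retract ⟨x, hx⟩).symm.trans hx')

theorem mem_of_commute {x g : G} (hx : x ∈ H) (hx1 : x ≠ 1) (hg : g * x = x * g) : g ∈ H := by
  by_contra hgH
  refine hx1 (h.malnormal g hgH x hx ?_)
  rwa [hg, mul_inv_cancel_right]

theorem card_ker_mul_card : Nat.card π.ker * Nat.card H = Nat.card G := by
  have hs : Function.Surjective π := fun x => ⟨x, h.retract x⟩
  rw [← π.ker.card_mul_index, Subgroup.index_ker, MonoidHom.range_eq_top.2 hs, Subgroup.card_top]

theorem apply_eq_of_isConj {a b : G} (hab : IsConj a b) : π a = π b := by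
  obtain ⟨c, rfl⟩ := isConj_iff.1 hab
  rw [map_mul, map_mul, map_inv, eq_mul_inv_iff_mul_eq]
  exact Subtype.ext (h.comm _ (π a).2 _ (π c).2)

variable [Finite G]

/-- For x = π g ≠ 1, the map k ↦ x⁻¹(k x k⁻¹) of `π.ker` to itself is injective, because `x`
commutes with no nontrivial kernel element. By finiteness it is surjective, hence hits x⁻¹g. -/
theorem exists_conj (g : G) (hg : π g ≠ 1) : ∃ k ∈ π.ker, k * π g * k⁻¹ = g := by
  have hg' : (π g : G) ≠ 1 := fun e => hg (Subtype.ext e)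
  let f : π.ker → π.ker := fun k =>
    ⟨(π g : G)⁻¹ * (k * π g * (k : G)⁻¹), by
      rw [MonoidHom.mem_ker]
      simp [h.apply_apply, MonoidHom.mem_ker.1 k.2]⟩
  have hf : Function.Injective f := fun a b hab => by
    have h1 : (a : G) * π g * (a : G)⁻¹ = b * π g * (b : G)⁻¹ :=
      mul_left_cancel (congrArg Subtype.val hab)
    have h2 : ((b : G)⁻¹ * a) * π g = π g * ((b : G)⁻¹ * a) := by
      calc ((b : G)⁻¹ * a) * π g = (b : G)⁻¹ * (a * π g * (a : G)⁻¹) * a := by group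
        _ = _ := by rw [h1]; group
    have h3 := h.eq_one_of_mem (h.mem_of_commute (π g).2 hg' h2)
      (mul_mem (inv_mem b.2) a.2)
    exact Subtype.ext (inv_mul_eq_one.1 h3).symm
  obtain ⟨k, hk⟩ := Finite.surjective_of_injective hf ⟨_, h.inv_mul_mem_ker g⟩
  exact ⟨k, k.2, mul_left_cancel (congrArg Subtype.val hk)⟩

theorem isConj_iff_of_ne (a b : G) (ha : π a ≠ 1) : IsConj a b ↔ π a = π b := by
  refine ⟨h.apply_eq_of_isConj, fun hab => ?_⟩
  obtain ⟨k, -, hk⟩ := h.exists_conj a ha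
  obtain ⟨l, -, hl⟩ := h.exists_conj b (hab ▸ ha)
  exact (isConj_iff.2 ⟨k, hk⟩).symm.trans (hab ▸ isConj_iff.2 ⟨l, hl⟩)

/-- If `g` outside the kernel centralised `k`, conjugation by a kernel element, which fixes `k`,
would carry `g` to `π g ≠ 1` in `H`; then `k` would lie in `H` and the kernel, so be trivial. -/
theorem card_centralizer_of_mem_ker {k : G} (hk : k ∈ π.ker) (hk1 : k ≠ 1) :
    Nat.card (Subgroup.centralizer {k}) = Nat.card π.ker := by
  congr 1
  have : Subgroup.centralizer {k} = π.ker := by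
    ext g
    rw [Subgroup.mem_centralizer_singleton_iff]
    refine ⟨fun hg => ?_, fun hg => h.ker_comm g hg k hk⟩
    by_contra hgK
    obtain ⟨t, ht, hgt⟩ := h.exists_conj g hgK
    have h1 : k * t = t * k := h.ker_comm k hk t ht
    have h2 : k * π g = π g * k := by
      have e : (π g : G) = t⁻¹ * g * t := by
        rw [mul_assoc, ← mul_inv_eq_iff_eq_mul.1 hgt, inv_mul_cancel_left]
      rw [e]
      calc k * (t⁻¹ * g * t) = t⁻¹ * (t * k) * t⁻¹ * g * t := by group
        _ = t⁻¹ * (k * g) * t := by rw [← h1]; group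
        _ = t⁻¹ * g * (k * t) := by rw [← hg]; group
        _ = t⁻¹ * g * t * k := by rw [h1]; group
    exact hk1 (h.eq_one_of_mem (h.mem_of_commute (π g).2 (fun e => hgK (Subtype.ext e)) h2) hk)
  rw [this]

theorem card_centralizer_of_notMem_ker {g : G} (hg : π g ≠ 1) :
    Nat.card (Subgroup.centralizer {g}) = Nat.card H := by
  classical
  have := Fintype.ofFinite G
  obtain ⟨k, -, hk⟩ := h.exists_conj g hg
  have hc : IsConj (π g : G) g := isConj_iff.2 ⟨k, hk⟩
  have h1 : Subgroup.centralizer {(π g : G)} = H := by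
    ext x
    rw [Subgroup.mem_centralizer_singleton_iff]
    exact ⟨fun hx => h.mem_of_commute (π g).2 (fun e => hg (Subtype.ext e)) hx,
      fun hx => h.comm x hx _ (π g).2⟩
  have h2 := card_isConj_mul_card_centralizer g
  have h3 := card_isConj_mul_card_centralizer (π g : G)
  have h4 : (Finset.univ.filter fun x => IsConj x (π g : G)) =
      Finset.univ.filter fun x => IsConj x g :=
    Finset.filter_congr fun x _ => ⟨fun e => e.trans hc, fun e => e.trans hc.symm⟩
  rw [h4, ← h2, h1] at h3
  refine (Nat.eq_of_mul_eq_mul_left (Finset.card_pos.2 ⟨g, ?_⟩) h3).symm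
  exact Finset.mem_filter.2 ⟨Finset.mem_univ _, IsConj.refl g⟩

end IsAbelianFrobenius

end Retraction

/-! ### Degrees of the irreducible characters -/

namespace IsAbelianFrobenius

variable {G : Type*} [Group G] [Finite G] {H : Subgroup G} {π : G →* H}

/-- The degree of an irreducible representation is at most the index of the abelian kernel. -/
theorem finrank_le (h : IsAbelianFrobenius H π) {V : Type*} [AddCommGroup V] [Module ℂ V]
    (ρ : Representation ℂ G V) (hρ : ρ.IsIrreducible) :
    Module.finrank ℂ V ≤ Nat.card H := by
  let : CommGroup π.ker := { mul_comm := fun x y => Subtype.ext (h.ker_comm x x.2 y y.2) }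
  have := Fintype.ofFinite H
  have hnt : Nontrivial V := by
    by_contra hV
    rw [not_nontrivial_iff_subsingleton] at hV
    apply (bot_ne_top : (⊥ : Subrepresentation ρ) ≠ ⊤)
    ext v
    simp [Subsingleton.elim v 0]
  obtain ⟨ψ, w, hw, hψ⟩ := exists_common_eigenvector
    ((ρ.comp π.ker.subtype : π.ker →* _) : Representation ℂ π.ker V)
  -- Writing g = π(g) · (kernel part), the kernel part scales `w`, so the h translates of `w` by `H`
  -- span an invariant subspace.
  let S : Submodule ℂ V := Submodule.span ℂ (Set.range fun x : H => ρ x w)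
  have hmem : ∀ g, ρ g w ∈ S := fun g => by
    have e : ρ g w = (ψ ⟨_, h.inv_mul_mem_ker g⟩ : ℂ) • ρ (π g) w := by
      rw [← map_smul, ← hψ]
      change _ = ρ (π g) (ρ ((π g : G)⁻¹ * g) w)
      rw [← Module.End.mul_apply, ← map_mul, mul_inv_cancel_left]
    rw [e]
    exact S.smul_mem _ (Submodule.subset_span ⟨π g, rfl⟩)
  let W : Subrepresentation ρ :=
    { toSubmodule := S
      apply_mem_toSubmodule := fun g v hv => by
        have : S ≤ S.comap (ρ g) := Submodule.span_le.2 <| by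
          rintro _ ⟨x, rfl⟩
          change ρ g (ρ x w) ∈ S
          rw [← Module.End.mul_apply, ← map_mul]
          exact hmem _
        exact this hv }
  have hS : S = ⊤ := by
    rcases eq_bot_or_eq_top W with hW | hW
    · exfalso
      have h1 : w ∈ S := by simpa using hmem 1
      change w ∈ W at h1
      rw [hW] at h1
      exact hw h1
    · exact congrArg Subrepresentation.toSubmodule hW
  rw [← finrank_top ℂ V, ← hS, Nat.card_eq_fintype_card]
  exact finrank_range_le_card _

theorem exists_degree_eq (h : IsAbelianFrobenius H π) (χ : Irr G) :
    ∃ d : ℕ, χ.1 1 = d ∧ d ≤ Nat.card H := by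
  obtain ⟨_, n, ρ, hρ, rfl⟩ := χ
  exact ⟨_, ρ.char_one, h.finrank_le ρ hρ⟩

end IsAbelianFrobenius

/-- A one-dimensional character as an irreducible character. -/
def linearIrr {G : Type*} [Group G] (ψ : G →* ℂˣ) : Irr G :=
  ⟨fun g => ψ g, by
    let ρ : Representation ℂ G ℂ :=
      { toFun := fun g => (ψ g : ℂ) • LinearMap.id
        map_one' := by ext; simp
        map_mul' := fun a b => by ext; simp [mul_comm] }
    have hρ : ρ.IsIrreducible :=
      { exists_pair_ne := ⟨⊥, ⊤, fun h => one_ne_zero (α := ℂ) <| by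
          have h1 : (1 : ℂ) ∈ (⊤ : Subrepresentation ρ) := Submodule.mem_top (R := ℂ)
          rw [← h] at h1
          exact h1⟩
        eq_bot_or_eq_top := fun W => by
          rcases eq_bot_or_eq_top (α := Submodule ℂ ℂ) W.toSubmodule with h | h
          · exact Or.inl (Subrepresentation.toSubmodule_injective h)
          · exact Or.inr (Subrepresentation.toSubmodule_injective h) }
    convert character_mem_irr ρ hρ using 1
    funext g
    simp [ρ, Representation.character]⟩

theorem linearIrr_apply {G : Type*} [Group G] (ψ : G →* ℂˣ) (g : G) :
    (linearIrr ψ).1 g = ψ g := rfl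

namespace IsAbelianFrobenius

theorem linearIrr_comp_injective {G : Type*} [Group G] {H : Subgroup G} {π : G →* H}
    (h : IsAbelianFrobenius H π) :
    Function.Injective fun ψ : H →* ℂˣ => linearIrr (ψ.comp π) := fun ψ φ e => by
  ext x
  have := congrFun (congrArg Subtype.val e) (x : G)
  simpa [linearIrr_apply, h.retract] using this

variable {G : Type*} [Group G] [Fintype G] {H : Subgroup G} {π : G →* H}

open Classical in
theorem sum_card_centralizer (h : IsAbelianFrobenius H π) :
    (∑ g : G, (Nat.card (Subgroup.centralizer {g}) : ℤ)) =
      Nat.card H * Nat.card π.ker + (Nat.card π.ker - 1) * Nat.card π.ker +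
        (Nat.card H * Nat.card π.ker - Nat.card π.ker) * Nat.card H := by
  -- Overlapping indicators: h everywhere, k - h more on the kernel, hk - k more at 1.
  have h1 : ∀ g : G, (Nat.card (Subgroup.centralizer {g}) : ℤ) =
      (if g = 1 then (Nat.card H * Nat.card π.ker - Nat.card π.ker : ℤ) else 0) +
      ((if g ∈ π.ker then (Nat.card π.ker - Nat.card H : ℤ) else 0) + Nat.card H) := fun g => by
    by_cases hg1 : g = 1
    · subst hg1
      have : Subgroup.centralizer {(1 : G)} = ⊤ := by
        ext g; simp [Subgroup.mem_centralizer_singleton_iff]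
      rw [if_pos rfl, if_pos (one_mem _), this, Subgroup.card_top, ← h.card_ker_mul_card]
      push_cast; ring
    · by_cases hg : g ∈ π.ker
      · rw [h.card_centralizer_of_mem_ker hg hg1, if_neg hg1, if_pos hg]; ring
      · rw [h.card_centralizer_of_notMem_ker hg, if_neg hg1, if_neg hg]; ring
  have hk : (Finset.univ.filter fun g => g ∈ π.ker).card = Nat.card π.ker := by
    rw [Nat.card_eq_fintype_card, Fintype.card_subtype]
  simp only [h1, Finset.sum_add_distrib]
  rw [← Finset.sum_filter (fun g => g ∈ π.ker)]
  simp only [Finset.sum_ite_eq', Finset.mem_univ, if_true, Finset.sum_const, hk, nsmul_eq_mul,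
    Finset.card_univ, ← Nat.card_eq_fintype_card, ← h.card_ker_mul_card]
  push_cast
  ring

theorem finite_monoidHom (h : IsAbelianFrobenius H π) : Finite (H →* ℂˣ) :=
  Finite.of_injective _ h.linearIrr_comp_injective

variable [Fintype (Irr G)]

/-- The number of characters not lifted from the complement. -/
theorem card_irr (h : IsAbelianFrobenius H π) :
    (Fintype.card (Irr G) : ℤ) * Nat.card H =
      Nat.card H * Nat.card H + (Nat.card π.ker - 1) := by
  have h1 := Irr.card_mul_card (G := G)
  have h2 : (Fintype.card (Irr G) : ℤ) * Nat.card G =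
    ∑ g : G, (Nat.card (Subgroup.centralizer {g}) : ℤ) := by exact_mod_cast h1
  rw [h.sum_card_centralizer, ← h.card_ker_mul_card] at h2
  have h3 : (Nat.card π.ker : ℤ) ≠ 0 := by exact_mod_cast Nat.card_pos.ne'
  apply mul_left_cancel₀ h3
  push_cast at h2
  linear_combination h2

/-- Integrality of the number of irreducible characters gives h ∣ k - 1, and k > 1 because `H` is
proper. -/
theorem card_lt_card_ker (h : IsAbelianFrobenius H π) : Nat.card H + 1 ≤ Nat.card π.ker := by
  have h1 : (Nat.card H : ℤ) ∣ Nat.card π.ker - 1 :=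
    ⟨Fintype.card (Irr G) - Nat.card H, by linear_combination -h.card_irr⟩
  have h2 : (1 : ℤ) < Nat.card π.ker := by
    have h4 : Nat.card π.ker ≠ 1 := fun e => h.ne_top <| Subgroup.eq_top_of_card_eq _ <| by
      rw [← h.card_ker_mul_card, e, one_mul]
    have : 0 < Nat.card π.ker := Nat.card_pos
    omega
  have := Int.le_of_dvd (by linarith) h1
  omega

theorem sum_irr_apply_one_sq (h : IsAbelianFrobenius H π) :
    ∑ χ : Irr G, χ.1 1 ^ 2 = (Nat.card π.ker : ℂ) * Nat.card H := by
  have h1 := Irr.sum_apply_mul_inv_apply (1 : G) 1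
  have : Subgroup.centralizer {(1 : G)} = ⊤ := by
    ext g; simp [Subgroup.mem_centralizer_singleton_iff]
  rw [if_pos (IsConj.refl _), this, Subgroup.card_top, ← h.card_ker_mul_card] at h1
  simpa [pow_two] using h1

open Classical in
theorem sum_linear (h : IsAbelianFrobenius H π) (a b : G) :
    ∑ χ ∈ (Set.range fun ψ : H →* ℂˣ => linearIrr (ψ.comp π)).toFinset, χ.1 a * χ.1 b⁻¹ =
      if π a = π b then (Nat.card H : ℂ) else 0 := by
  let : CommGroup H := { mul_comm := fun x y => Subtype.ext (h.comm x x.2 y y.2) }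
  have := h.finite_monoidHom
  have := Fintype.ofFinite (H →* ℂˣ)
  have e := sum_monoidHom_units_apply H (π a * (π b)⁻¹)
  rw [Set.toFinset_range, Finset.sum_image h.linearIrr_comp_injective.injOn]
  simp only [mul_inv_eq_one] at e
  rw [← e]
  refine Finset.sum_congr rfl fun ψ _ => ?_
  simp [linearIrr_apply]

/-- A character not lifted from the complement has degree the order of the complement. -/
theorem degree_of_notMem_range (h : IsAbelianFrobenius H π) (χ : Irr G)
    (hχ : χ ∉ Set.range fun ψ : H →* ℂˣ => linearIrr (ψ.comp π)) :
    χ.1 1 ^ 2 = (Nat.card H : ℂ) ^ 2 := by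
  classical
  choose d hd hle using h.exists_degree_eq
  let L := (Set.range fun ψ : H →* ℂˣ => linearIrr (ψ.comp π)).toFinset
  have hL1 : ∀ χ ∈ L, χ.1 1 = 1 := fun χ hχ => by
    obtain ⟨ψ, rfl⟩ := Set.mem_toFinset.1 hχ
    simp [linearIrr_apply]
  have hL : (L.card : ℂ) = Nat.card H := by
    have := h.sum_linear 1 1
    rw [if_pos rfl, Finset.sum_congr rfl (g := fun _ => 1) fun χ hχ => by
      rw [inv_one, hL1 χ hχ, mul_one]] at this
    simpa [L] using this
  have hLN : L.card = Nat.card H := by exact_mod_cast hL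
  have hsq : ∑ χ ∈ L, χ.1 1 ^ 2 = (Nat.card H : ℂ) := by
    rw [Finset.sum_congr rfl (g := fun _ => 1) fun χ hχ => by rw [hL1 χ hχ, one_pow]]
    simpa using hL
  -- Both sides equal h³ - h, so the h² - d² outside `L` sum to zero; being nonnegative, each of
  -- them vanishes.
  have htot : ∑ χ : Irr G, ((Nat.card H : ℂ) ^ 2 - χ.1 1 ^ 2) =
      ∑ χ ∈ L, ((Nat.card H : ℂ) ^ 2 - χ.1 1 ^ 2) := by
    rw [Finset.sum_sub_distrib, Finset.sum_sub_distrib, h.sum_irr_apply_one_sq, hsq,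
      Finset.sum_const, Finset.sum_const, hLN, Finset.card_univ]
    have := h.card_irr
    have h2 : (Fintype.card (Irr G) : ℂ) * Nat.card H =
      Nat.card H * Nat.card H + (Nat.card π.ker - 1) := by exact_mod_cast this
    simp only [nsmul_eq_mul]
    linear_combination (Nat.card H : ℂ) * h2
  have hzero : ∑ χ ∈ Lᶜ, ((Nat.card H : ℂ) ^ 2 - χ.1 1 ^ 2) = 0 := by
    rw [← Finset.sum_add_sum_compl L] at htot
    simpa using htot
  simp only [hd] at hzero
  have hzero' : ∑ χ ∈ Lᶜ, ((Nat.card H : ℤ) ^ 2 - d χ ^ 2) = 0 := by exact_mod_cast hzero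
  have h3 := (Finset.sum_eq_zero_iff_of_nonneg fun χ _ => by
    have : (d χ : ℤ) ≤ Nat.card H := by exact_mod_cast hle χ
    have h0 : (0 : ℤ) ≤ d χ := by positivity
    nlinarith).1 hzero' χ (by simpa [L] using hχ)
  rw [hd]
  have h4 : (d χ : ℤ) ^ 2 = Nat.card H ^ 2 := by linarith
  exact_mod_cast h4

open Classical in
/-- The coefficient of the ZL-amenability constant at a pair of group elements. -/
theorem sum_degree_sq_mul (h : IsAbelianFrobenius H π) (a b : G) :
    ∑ χ : Irr G, χ.1 1 ^ 2 * (χ.1 a * χ.1 b⁻¹) =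
      (Nat.card H : ℂ) ^ 2 *
        (if IsConj a b then (Nat.card (Subgroup.centralizer {b}) : ℂ) else 0) -
      ((Nat.card H : ℂ) ^ 2 - 1) * if π a = π b then (Nat.card H : ℂ) else 0 := by
  let L := (Set.range fun ψ : H →* ℂˣ => linearIrr (ψ.comp π)).toFinset
  rw [← Irr.sum_apply_mul_inv_apply, ← h.sum_linear, ← Finset.sum_add_sum_compl L,
    ← Finset.sum_add_sum_compl L (fun χ => χ.1 a * χ.1 b⁻¹)]
  rw [Finset.sum_congr rfl (s₁ := L) (g := fun χ => χ.1 a * χ.1 b⁻¹), Finset.sum_congr rfl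
    (s₁ := Lᶜ) (g := fun χ => (Nat.card H : ℂ) ^ 2 * (χ.1 a * χ.1 b⁻¹)), ← Finset.mul_sum]
  · ring
  · intro χ hχ
    rw [h.degree_of_notMem_range χ (by simpa [L] using hχ)]
  · intro χ hχ
    obtain ⟨ψ, rfl⟩ := Set.mem_toFinset.1 hχ
    simp [linearIrr_apply]

end IsAbelianFrobenius

/-! ### Absolute values of the coefficients and the closed formula -/

namespace IsAbelianFrobenius

variable {G : Type*} [Group G] [Fintype G] {H : Subgroup G} {π : G →* H}

open Classical in
theorem card_fiber (π : G →* H) (a : G) :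
    (Finset.univ.filter fun b => π a = π b).card = Nat.card π.ker := by
  rw [Nat.card_eq_fintype_card, Fintype.card_subtype]
  refine Finset.card_bij (fun b _ => a⁻¹ * b) ?_ ?_ ?_
  · intro b hb
    simpa [MonoidHom.mem_ker, inv_mul_eq_one] using hb
  · intro b _ c _ e
    exact mul_left_cancel e
  · intro k hk
    refine ⟨a * k, ?_, by simp⟩
    have : π k = 1 := by simpa [MonoidHom.mem_ker] using hk
    simp [this]

open Classical in
-- Off the kernel, being conjugate and having equal image under `π` coincide, so the coefficient is
-- h³ - (h² - 1)h = h or 0.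
theorem norm_sum_of_notMem_ker (h : IsAbelianFrobenius H π) [Fintype (Irr G)] {a : G}
    (ha : π a ≠ 1) (b : G) : ‖∑ χ : Irr G, χ.1 1 ^ 2 * (χ.1 a * χ.1 b⁻¹)‖ =
      if π a = π b then (Nat.card H : ℝ) else 0 := by
  rw [h.sum_degree_sq_mul]
  simp only [h.isConj_iff_of_ne a b ha]
  split_ifs with hab
  · rw [h.card_centralizer_of_notMem_ker (hab ▸ ha),
      show (Nat.card H : ℂ) ^ 2 * Nat.card H - (Nat.card H ^ 2 - 1) * Nat.card H = Nat.card H by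
        ring, Complex.norm_natCast]
  · simp

theorem card_ker_le_card_centralizer (h : IsAbelianFrobenius H π) {b : G} (hb : π b = 1) :
    Nat.card π.ker ≤ Nat.card (Subgroup.centralizer {b}) :=
  Subgroup.card_le_of_le fun k hk => by
    rw [Subgroup.mem_centralizer_singleton_iff]
    exact h.ker_comm k hk b hb

open Classical in
-- On non-conjugate pairs in the kernel the coefficient is -(h² - 1)h; on conjugate pairs it is
-- positive, since centralisers have order at least k ≥ h + 1. The second summand corrects the
-- flipped sign on conjugate pairs.
theorem norm_sum_of_mem_ker (h : IsAbelianFrobenius H π) [Fintype (Irr G)] {a : G}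
    (ha : π a = 1) (b : G) : ‖∑ χ : Irr G, χ.1 1 ^ 2 * (χ.1 b * χ.1 a⁻¹)‖ =
      (if π a = π b then ((Nat.card H : ℝ) ^ 2 - 1) * Nat.card H else 0) +
      if IsConj b a then (Nat.card H : ℝ) ^ 2 * Nat.card (Subgroup.centralizer {a}) -
        2 * ((Nat.card H : ℝ) ^ 2 - 1) * Nat.card H else 0 := by
  have hH : (1 : ℝ) ≤ Nat.card H := by exact_mod_cast Nat.card_pos
  have hK : (Nat.card H + 1 : ℝ) ≤ Nat.card π.ker := by exact_mod_cast h.card_lt_card_ker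
  have hC : (Nat.card π.ker : ℝ) ≤ Nat.card (Subgroup.centralizer {a}) := by
    exact_mod_cast h.card_ker_le_card_centralizer ha
  rw [h.sum_degree_sq_mul]
  simp only [eq_comm (a := π a)]
  by_cases hab : IsConj b a
  · have hπ := h.apply_eq_of_isConj hab
    simp only [if_pos hab, if_pos hπ]
    have e : (Nat.card H : ℂ) ^ 2 * Nat.card (Subgroup.centralizer {a}) -
        (Nat.card H ^ 2 - 1) * Nat.card H =
        (((Nat.card H : ℝ) ^ 2 * Nat.card (Subgroup.centralizer {a}) -
          (Nat.card H ^ 2 - 1) * Nat.card H : ℝ) : ℂ) := by push_cast; ring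
    rw [e, Complex.norm_real, Real.norm_of_nonneg]
    · ring
    · nlinarith [sq_nonneg (Nat.card H : ℝ)]
  · simp only [if_neg hab]
    split_ifs
    · have e : (Nat.card H : ℂ) ^ 2 * 0 - (Nat.card H ^ 2 - 1) * Nat.card H =
        ((-((Nat.card H ^ 2 - 1) * Nat.card H) : ℝ) : ℂ) := by push_cast; ring
      rw [e, Complex.norm_real, norm_neg, Real.norm_of_nonneg, add_zero]
      exact mul_nonneg (by nlinarith) (by linarith)
    · simp

theorem norm_sum_comm [Fintype (Irr G)] (a b : G) :
    ‖∑ χ : Irr G, χ.1 1 ^ 2 * (χ.1 a * χ.1 b⁻¹)‖ =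
      ‖∑ χ : Irr G, χ.1 1 ^ 2 * (χ.1 b * χ.1 a⁻¹)‖ := by
  rw [← Complex.norm_conj, map_sum]
  congr 1
  refine Finset.sum_congr rfl fun χ _ => ?_
  have h1 : (starRingEnd ℂ) (χ.1 1) = χ.1 1 := by rw [← Irr.apply_inv, inv_one]
  rw [map_mul, map_mul, map_pow, h1, ← Irr.apply_inv, ← Irr.apply_inv, inv_inv, mul_comm (χ.1 a⁻¹)]

open Classical in
-- For `a` in the kernel the row sum is hk + 2(h² - 1)h(k - c), with c the class size of `a`: c = h,
-- except c = 1 at the identity, which the last term accounts for.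
theorem sum_norm_sum (h : IsAbelianFrobenius H π) [Fintype (Irr G)] (a : G) :
    ∑ b : G, ‖∑ χ : Irr G, χ.1 1 ^ 2 * (χ.1 a * χ.1 b⁻¹)‖ =
      (Nat.card H * Nat.card π.ker : ℝ) +
      (if a ∈ π.ker then 2 * ((Nat.card H : ℝ) ^ 2 - 1) * Nat.card H *
        (Nat.card π.ker - Nat.card H) else 0) +
      if a = 1 then 2 * ((Nat.card H : ℝ) ^ 2 - 1) * Nat.card H * (Nat.card H - 1) else 0 := by
  by_cases ha : π a = 1
  · have hcl : ((Finset.univ.filter fun b => IsConj b a).card *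
        Nat.card (Subgroup.centralizer {a}) : ℝ) = Nat.card π.ker * Nat.card H := by
      exact_mod_cast (card_isConj_mul_card_centralizer a).trans h.card_ker_mul_card.symm
    simp only [norm_sum_comm a, h.norm_sum_of_mem_ker ha, Finset.sum_add_distrib]
    rw [← Finset.sum_filter, ← Finset.sum_filter, Finset.sum_const, Finset.sum_const, card_fiber π,
      if_pos (MonoidHom.mem_ker.2 ha), nsmul_eq_mul, nsmul_eq_mul]
    have hcard : ((Finset.univ.filter fun b => IsConj b a).card : ℝ) =
        if a = 1 then 1 else (Nat.card H : ℝ) := by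
      split_ifs with h1
      · subst h1
        exact_mod_cast Finset.card_eq_one.2 ⟨1, by ext; simp⟩
      · rw [h.card_centralizer_of_mem_ker ha h1, mul_comm (Nat.card π.ker : ℝ)] at hcl
        exact mul_right_cancel₀ (Nat.cast_ne_zero.2 Nat.card_pos.ne') hcl
    rw [mul_sub, mul_left_comm ((Finset.univ.filter fun b => IsConj b a).card : ℝ), hcl, hcard]
    split_ifs <;> ring
  · have ha1 : a ≠ 1 := fun e => ha (by rw [e, map_one])
    simp only [h.norm_sum_of_notMem_ker ha]
    rw [← Finset.sum_filter, Finset.sum_const, card_fiber π, nsmul_eq_mul, if_neg ha1,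
      if_neg (fun e => ha (MonoidHom.mem_ker.1 e))]
    ring

/-- The ZL-amenability constant of a Frobenius group with abelian complement and kernel. -/
theorem AMZ_eq (h : IsAbelianFrobenius H π) :
    AMZ G = ((Nat.card π.ker : ℝ) ^ 2 * (2 * Nat.card H ^ 2 + Nat.card H - 2) -
        2 * (Nat.card H ^ 2 - 1) * (Nat.card H * Nat.card π.ker - Nat.card H + 1)) /
      (Nat.card H * Nat.card π.ker ^ 2) := by
  classical
  have := Fintype.ofFinite (Irr G)
  have hH : (Nat.card H : ℝ) ≠ 0 := Nat.cast_ne_zero.2 Nat.card_pos.ne'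
  have hK : (Nat.card π.ker : ℝ) ≠ 0 := Nat.cast_ne_zero.2 Nat.card_pos.ne'
  have hk : (Finset.univ.filter fun g => g ∈ π.ker).card = Nat.card π.ker := by
    rw [Nat.card_eq_fintype_card, Fintype.card_subtype]
  rw [AMZ_eq_sum]
  simp only [h.sum_norm_sum, Finset.sum_add_distrib]
  rw [← Finset.sum_filter (fun g => g ∈ π.ker), Finset.sum_const, Finset.sum_const, hk,
    Finset.sum_ite_eq', if_pos (Finset.mem_univ _), Finset.card_univ, ← Nat.card_eq_fintype_card,
    ← h.card_ker_mul_card, nsmul_eq_mul, nsmul_eq_mul]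
  push_cast
  field_simp
  ring

/-! ### The minimum and the equality case -/

theorem two_le_card (h : IsAbelianFrobenius H π) : 2 ≤ Nat.card H := by
  have : Nat.card H ≠ 1 := fun e => h.ne_bot (Subgroup.card_eq_one.1 e)
  have : 0 < Nat.card H := Nat.card_pos
  omega

theorem le_AMZ_and_eq_iff (h : IsAbelianFrobenius H π) :
    7 / 3 ≤ AMZ G ∧ (AMZ G = 7 / 3 ↔ Nat.card H = 2 ∧ Nat.card π.ker = 3) := by
  have := Fintype.ofFinite (Irr G)
  obtain ⟨t, ht⟩ := Nat.exists_eq_add_of_le h.two_le_card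
  obtain ⟨m, hm⟩ := Nat.exists_eq_add_of_le h.card_lt_card_ker
  -- With h = 2 + t and k = h + 1 + m the numerator has only nonnegative coefficients; its terms in
  -- t alone force t = 0, and then 10m² + 24m = 0 forces m = 0.
  have key : AMZ G - 7 / 3 = ((10 + 20 * t + 6 * t ^ 2) * m ^ 2 +
      (6 * t ^ 3 + 40 * t ^ 2 + 74 * t + 24) * m + (t + 3) * (8 * t ^ 2 + 16 * t)) /
      (3 * (2 + t) * (3 + t + m) ^ 2) := by
    rw [h.AMZ_eq, hm, ht]
    push_cast
    have : (2 + t + 1 + m : ℝ) ≠ 0 := by positivity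
    have : (2 + t : ℝ) ≠ 0 := by positivity
    have : (3 + t + m : ℝ) ≠ 0 := by positivity
    field_simp
    ring
  refine ⟨sub_nonneg.1 (key ▸ by positivity), fun e => ?_, fun ⟨e1, e2⟩ => ?_⟩
  · rw [e, sub_self, eq_comm, div_eq_zero_iff] at key
    have h1 := key.resolve_right (by positivity)
    have h2 : (10 + 20 * t + 6 * t ^ 2) * m ^ 2 +
      (6 * t ^ 3 + 40 * t ^ 2 + 74 * t + 24) * m + (t + 3) * (8 * t ^ 2 + 16 * t) = 0 := by
      exact_mod_cast h1
    simp at h2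
    omega
  · have ht0 : t = 0 := by omega
    have hm0 : m = 0 := by omega
    subst ht0 hm0
    simpa [sub_eq_zero] using key

/-- `G` acts on the three cosets of `H`; malnormality makes the core of `H` trivial, so the action
is faithful, and 6 = 3!. -/
theorem nonempty_mulEquiv_perm (h : IsAbelianFrobenius H π) (hH : Nat.card H = 2)
    (hK : Nat.card π.ker = 3) : Nonempty (G ≃* Equiv.Perm (ZMod 3)) := by
  classical
  have hG : Nat.card G = 6 := by rw [← h.card_ker_mul_card, hH, hK]
  have hQ : Nat.card (G ⧸ H) = 3 := by
    have := H.card_eq_card_quotient_mul_card_subgroup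
    rw [hG, hH] at this
    omega
  obtain ⟨e⟩ : Nonempty ((G ⧸ H) ≃ ZMod 3) := Finite.card_eq.1 (by rw [hQ, Nat.card_zmod])
  let f : G →* Equiv.Perm (ZMod 3) :=
    e.permCongrHom.toMonoidHom.comp (MulAction.toPermHom G (G ⧸ H))
  have hf : Function.Injective f := by
    refine e.permCongrHom.injective.comp ((injective_iff_map_eq_one _).2 fun x hx => ?_)
    have hx' : ∀ g : G, g⁻¹ * x * g ∈ H := fun g => by
      have h1 : x • (g : G ⧸ H) = g := congrArg (fun p : Equiv.Perm (G ⧸ H) => p g) hx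
      rw [MulAction.Quotient.smul_coe, eq_comm, QuotientGroup.eq] at h1
      simpa [mul_assoc] using h1
    obtain ⟨g, hg⟩ : ∃ g, g ∉ H := by
      by_contra! hall
      exact h.ne_top (eq_top_iff.2 fun g _ => hall g)
    exact h.malnormal g⁻¹ (by simpa using hg) x (by simpa using hx' 1) (by simpa using hx' g)
  refine ⟨MulEquiv.ofBijective f ((Nat.bijective_iff_injective_and_card _).2 ⟨hf, ?_⟩)⟩
  rw [hG, Nat.card_perm, Nat.card_zmod]
  rfl

end IsAbelianFrobenius

theorem nonempty_dihedralGroup_three_mulEquiv_perm :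
    Nonempty (DihedralGroup 3 ≃* Equiv.Perm (ZMod 3)) := by
  let f : DihedralGroup 3 → Equiv.Perm (ZMod 3)
    -- The sign matches the convention `sr i * sr j = r (j - i)`.
    | .r i => Equiv.addLeft (-i)
    | .sr i => Equiv.subLeft i
  have hmul : ∀ a b, f (a * b) = f a * f b := by
    rintro (i | i) (j | j) <;> ext x <;> simp [f] <;> ring_nf
  have hinj : Function.Injective f := by decide
  refine ⟨MulEquiv.ofBijective (MonoidHom.mk' f hmul)
    ((Nat.bijective_iff_injective_and_card _).2 ⟨hinj, ?_⟩)⟩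
  rw [DihedralGroup.nat_card, Nat.card_perm, Nat.card_zmod]
  rfl

theorem IsAbelianFrobenius.nonempty_mulEquiv_dihedralGroup_iff {G : Type*} [Group G] [Finite G]
    {H : Subgroup G} {π : G →* H} (h : IsAbelianFrobenius H π) :
    Nonempty (G ≃* DihedralGroup 3) ↔ Nat.card H = 2 ∧ Nat.card π.ker = 3 := by
  have := Fintype.ofFinite G
  have := Fintype.ofFinite (Irr G)
  constructor
  · rintro ⟨e⟩
    have h1 := h.card_ker_mul_card
    rw [Nat.card_congr e.toEquiv, DihedralGroup.nat_card] at h1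
    have h2 := h.two_le_card
    have h3 := h.card_lt_card_ker
    -- hk = 6 with k ≥ h + 1 excludes h ≥ 3.
    have h4 : Nat.card H = 2 := by nlinarith
    rw [h4] at h1
    omega
  · rintro ⟨h1, h2⟩
    obtain ⟨e⟩ := h.nonempty_mulEquiv_perm h1 h2
    obtain ⟨e'⟩ := nonempty_dihedralGroup_three_mulEquiv_perm
    exact ⟨e.trans e'.symm⟩

end ZLAmenability

theorem theorem3p7 (G : Type*) [Group G] [Finite G] (H : Subgroup G)
    (hH : ZLAmenability.IsFrobeniusComplement H)
    (hHab : ∀ x ∈ H, ∀ y ∈ H, x * y = y * x)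
    (hKab : ∀ x ∈ ZLAmenability.frobeniusKernel H, ∀ y ∈ ZLAmenability.frobeniusKernel H,
      x * y = y * x) :
    7 / 3 ≤ ZLAmenability.AMZ G ∧
      (ZLAmenability.AMZ G = 7 / 3 ↔ Nonempty (G ≃* DihedralGroup 3)) := by
  have := Fintype.ofFinite G
  obtain ⟨π, h⟩ := hH.exists_isAbelianFrobenius hHab hKab
  rw [h.nonempty_mulEquiv_dihedralGroup_iff]
  exact h.le_AMZ_and_eq_iff
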